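/- Let $P\subset\mathbb R^n$ be a full-dimensional lattice polytope, i.e. the convex hull of finitely many points of $\mathbb Z^n$ whose affine span is all of $\mathbb R^n$. Let $\varphi:\mathbb R^n\to\mathbb C$ be a homogeneous polynomial function, and let $f$ be an arbitrary function assigning to each nonempty face $Q$ of $P$ (including $Q=P$) a Laurent polynomial $f_Q(y)\in\mathbb Z[y^{\pm1}]$. For each integer $\ell>0$ put $$E^\varphi_{P,f}(\ell,y):=\sum_{\emptyset\ne Q\preceq P} f_Q(y)\,(1+y)^{\dim Q+\deg\varphi}\sum_{m\in\mathrm{Relint}(\ell Q)\cap\mathbb Z^n}\varphi(m)\ \in\ \mathbb C[y^{\pm1}],$$ $$\widetilde E^\varphi_{P,f}(\ell,y):=\sum_{\emptyset\ne Q\preceq P} f_Q(y)\,(1+y)^{\dim Q}\sum_{m\in\mathrm{Relint}(\ell Q)\cap\mathbb Z^n}\varphi(m),$$ where $\mathrm{Relint}(\ell Q)$ is the relative interior of the dilated face $\ell Q$ (and $\deg 0:=0$ if $\varphi=0$). Then $E^\varphi_{P,f}(\ell,y)=(1+y)^{\deg\varphi}\,\widetilde E^\varphi_{P,f}(\ell,y)$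 for all integers $\ell>0$, and there is a polynomial $E^\varphi_{P,f}(z,y)\in\mathbb C[y^{\pm1}][z]$ in $z$, independent of $\ell$, whose value at $z=\ell$ is $E^\varphi_{P,f}(\ell,y)$ for every integer $\ell>0$. -/

import Mathlib

open scoped LaurentPolynomial Pointwise

noncomputable section

/-- The point of `ℝⁿ` with the given integral coordinates: the inclusion of the lattice
`M = ℤⁿ` into `M_ℝ = ℝⁿ`. -/
def latticeVec {n : ℕ} (m : Fin n → ℤ) : Fin n → ℝ := fun i => (m i : ℝ)

/-- A lattice polytope in `ℝⁿ`: the convex hull of finitely many points of `ℤⁿ`. -/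
structure LatticePolytope (n : ℕ) where
  /-- the underlying set of points -/
  carrier : Set (Fin n → ℝ)
  isHull : ∃ V : Finset (Fin n → ℤ), carrier = convexHull ℝ (latticeVec '' (V : Set (Fin n → ℤ)))

namespace LatticePolytope

variable {n : ℕ}

/-- A polytope is full-dimensional if its affine span is the whole space. -/
def FullDimensional (P : LatticePolytope n) : Prop :=
  affineSpan ℝ P.carrier = ⊤

/-- The nonempty faces of `P` (with `P` itself, if nonempty, among them): the nonempty sets of
all points of `P` at which some linear functional attains its maximum over `P`. -/
def Face (P : LatticePolytope n) : Type :=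
  {Q : Set (Fin n → ℝ) // Q.Nonempty ∧ IsExposed ℝ P.carrier Q}

namespace Face

variable {P : LatticePolytope n}

/-- The set of points of a face. -/
def carrier (Q : P.Face) : Set (Fin n → ℝ) := Q.1

/-- The dimension of a face: the dimension of its affine span. -/
def dim (Q : P.Face) : ℕ := Module.finrank ℝ (vectorSpan ℝ Q.carrier)

end Face

theorem isCompact (P : LatticePolytope n) : IsCompact P.carrier := by
  obtain ⟨V, hV⟩ := P.isHull
  rw [hV]
  exact (V.finite_toSet.image latticeVec).isCompact_convexHull (𝕜 := ℝ)

theorem convex (P : LatticePolytope n) : Convex ℝ P.carrier := by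
  obtain ⟨V, hV⟩ := P.isHull
  rw [hV]
  exact convex_convexHull ℝ _

/-- A polytope has only finitely many faces. -/
instance finite_face (P : LatticePolytope n) : Finite P.Face := by
  obtain ⟨V, hV⟩ := P.isHull
  have hfin : (latticeVec '' (V : Set (Fin n → ℤ))).Finite := V.finite_toSet.image latticeVec
  have hmem : ∀ Q : P.Face,
      Q.1.extremePoints ℝ ∈ (latticeVec '' (V : Set (Fin n → ℤ))).powerset := by
    intro Q
    have h1 : Q.1.extremePoints ℝ ⊆ P.carrier.extremePoints ℝ :=
      Q.2.2.isExtreme.extremePoints_subset_extremePoints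
    intro x hx
    have h2 := h1 hx
    rw [hV] at h2
    exact extremePoints_convexHull_subset h2
  have : Finite ((latticeVec '' (V : Set (Fin n → ℤ))).powerset) :=
    hfin.powerset.to_subtype
  refine Finite.of_injective
    (fun Q : P.Face => (⟨Q.1.extremePoints ℝ, hmem Q⟩ :
      (latticeVec '' (V : Set (Fin n → ℤ))).powerset)) ?_
  intro Q R h
  have h' : Q.1.extremePoints ℝ = R.1.extremePoints ℝ := congrArg Subtype.val h
  have key : ∀ S : P.Face, closure (convexHull ℝ (S.1.extremePoints ℝ)) = S.1 := fun S =>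
    closure_convexHull_extremePoints (S.2.2.isCompact P.isCompact) (S.2.2.convex P.convex)
  exact Subtype.ext (by rw [← key Q, ← key R, h'])

instance fintype_face (P : LatticePolytope n) : Fintype P.Face := Fintype.ofFinite _

namespace Face

variable {P : LatticePolytope n}

/-- The relative interior of a dilated face contains only finitely many lattice points. -/
theorem finite_relint (Q : P.Face) (l : ℕ) :
    {m : Fin n → ℤ | latticeVec m ∈ intrinsicInterior ℝ ((l : ℝ) • Q.carrier)}.Finite := by
  have hc : IsCompact ((l : ℝ) • Q.carrier) := (Q.2.2.isCompact P.isCompact).smul (l : ℝ)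
  obtain ⟨r, hr⟩ := hc.isBounded.subset_closedBall 0
  refine (Set.finite_Icc (fun _ : Fin n => -⌈r⌉) (fun _ => ⌈r⌉)).subset ?_
  intro m hm
  have h1 := hr (intrinsicInterior_subset hm)
  rw [mem_closedBall_zero_iff] at h1
  have h2 : ∀ i, |(m i : ℝ)| ≤ (⌈r⌉ : ℝ) := fun i =>
    ((norm_le_pi_norm (latticeVec m) i).trans h1).trans (Int.le_ceil r)
  refine ⟨fun i => ?_, fun i => ?_⟩
  · have := (abs_le.mp (h2 i)).1
    exact_mod_cast this
  · have := (abs_le.mp (h2 i)).2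
    exact_mod_cast this

/-- The finite set `Relint(l Q) ∩ ℤⁿ` of lattice points in the relative interior of the dilated
face `l Q`. -/
def relintPoints (Q : P.Face) (l : ℕ) : Finset (Fin n → ℤ) :=
  (Q.finite_relint l).toFinset

/-- The sum of the values of `φ` over `Relint(l Q) ∩ ℤⁿ`. -/
def relintSum (Q : P.Face) (φ : MvPolynomial (Fin n) ℂ) (l : ℕ) : ℂ :=
  ∑ m ∈ Q.relintPoints l, MvPolynomial.eval (fun i => (m i : ℂ)) φ

end Face

/-- The inclusion `ℤ[y, y⁻¹] → ℂ[y, y⁻¹]`. -/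
def laurentIncl : ℤ[T;T⁻¹] →+* ℂ[T;T⁻¹] :=
  AddMonoidAlgebra.mapRingHom ℤ (Int.castRingHom ℂ)

/-- The expression `E^φ_{P,f}(l, y)`, a Laurent polynomial in `y = T 1` over `ℂ`:
`∑_Q f_Q(y) (1 + y)^(dim Q + deg φ) ∑_{m ∈ Relint(l Q) ∩ ℤⁿ} φ(m)`, with `Q` running over the
nonempty faces of `P`. -/
def weightedEhrhart (P : LatticePolytope n) (f : P.Face → ℤ[T;T⁻¹])
    (φ : MvPolynomial (Fin n) ℂ) (l : ℕ) : ℂ[T;T⁻¹] :=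
  ∑ Q : P.Face, laurentIncl (f Q) * (1 + LaurentPolynomial.T 1) ^ (Q.dim + φ.totalDegree) *
    LaurentPolynomial.C (Q.relintSum φ l)

/-- The renormalized expression
`∑_Q f_Q(y) (1 + y)^(dim Q) ∑_{m ∈ Relint(l Q) ∩ ℤⁿ} φ(m)`. -/
def weightedEhrhartTilde (P : LatticePolytope n) (f : P.Face → ℤ[T;T⁻¹])
    (φ : MvPolynomial (Fin n) ℂ) (l : ℕ) : ℂ[T;T⁻¹] :=
  ∑ Q : P.Face, laurentIncl (f Q) * (1 + LaurentPolynomial.T 1) ^ Q.dim *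
    LaurentPolynomial.C (Q.relintSum φ l)

end LatticePolytope

end

/-! The factorization is `pow_add` face by face. For polynomiality it suffices that each face sum
`Q.relintSum φ l` is a polynomial in `l` for `l > 0`. A face is the hull of lattice points `v i`,
and the relative interior of its dilate by `l` is the slice at height `l` of the open cone on the
vectors `(v i, 1)`. That cone is cut into disjoint open simplicial cones
(`exists_simplicial_partition`): every point has a nonnegative representation minimizing a generic
functional, and the support of the minimizer indexes its piece. This is a regular triangulation
obtained by linear programming. In a simplicial cone, each lattice point is uniquely a box point
plus a nonnegative integral combination of generators. The weighted sum thus becomes finitely many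
sums over compositions of `l - h`, where `h` is the height of the box point. These are polynomial by
a generating function argument (`exists_polynomial_sum_finsuppAntidiag`), whose vanishing clause
makes the formula right also when `l < h`. -/

/-! ### Simplicial decomposition of an open cone. -/

/-- The positive combinations of the vectors `w i`, `i ∈ S`. -/
def openCone {ι E : Type*} [Fintype ι] [AddCommGroup E] [Module ℝ E] (w : ι → E)
    (S : Finset ι) : Set E :=
  {x | ∃ c : ι → ℝ, (∀ i, 0 ≤ c i) ∧ (∀ i, i ∈ S ↔ 0 < c i) ∧ ∑ i, c i • w i = x}

/-- The vectors `w i`, `i ∈ S`, are linearly independent. -/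
def IndepOn {ι E : Type*} [Fintype ι] [AddCommGroup E] [Module ℝ E] (w : ι → E)
    (S : Finset ι) : Prop :=
  ∀ c : ι → ℝ, (∀ i ∉ S, c i = 0) → ∑ i, c i • w i = 0 → c = 0

theorem exists_pos_forall_add_mul_pos {ι : Type*} [Finite ι] (a c : ι → ℝ) :
    ∃ ε > 0, ∀ i, 0 < a i → 0 < a i + ε * c i := by
  have h : ∀ᶠ ε in nhdsWithin (0 : ℝ) (Set.Ioi 0), ∀ i, 0 < a i → 0 < a i + ε * c i := by
    rw [Filter.eventually_all]
    intro i
    by_cases hi : 0 < a i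
    · have hc : Continuous fun ε : ℝ => a i + ε * c i := by fun_prop
      have h0 : ∀ᶠ ε in nhds (0 : ℝ), 0 < a i + ε * c i :=
        hc.continuousAt.eventually (lt_mem_nhds (by simpa using hi))
      exact (h0.filter_mono nhdsWithin_le_nhds).mono fun _ h _ => h
    · exact Filter.Eventually.of_forall fun _ h => absurd h hi
  obtain ⟨ε, h1, h2⟩ := (h.and self_mem_nhdsWithin).exists
  exact ⟨ε, h2, h1⟩

theorem sum_add_mul_smul {ι E : Type*} [Fintype ι] [AddCommGroup E] [Module ℝ E] (w : ι → E)
    (a c : ι → ℝ) (ε : ℝ) :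
    ∑ i, (a i + ε * c i) • w i = ∑ i, a i • w i + ε • ∑ i, c i • w i := by
  simp only [add_smul, mul_smul, Finset.sum_add_distrib, Finset.smul_sum]

/-- `a` minimizes the functional `f` among the nonnegative coefficient vectors that represent
the same combination of the vectors `w i`. -/
def IsOptimal {ι E : Type*} [Fintype ι] [AddCommGroup E] [Module ℝ E] (w : ι → E)
    (f : (ι → ℝ) →ₗ[ℝ] ℝ) (a : ι → ℝ) : Prop :=
  ∀ b : ι → ℝ, (∀ i, 0 ≤ b i) → ∑ i, b i • w i = ∑ i, a i • w i → f a ≤ f b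

section

variable {ι E : Type*} [Fintype ι]

/-- Optimality depends only on the support. -/
theorem IsOptimal.of_support [AddCommGroup E] [Module ℝ E] {w : ι → E}
    {f : (ι → ℝ) →ₗ[ℝ] ℝ} {a b : ι → ℝ}
    (ha : ∀ i, 0 ≤ a i) (hab : ∀ i, 0 < b i → 0 < a i) (h : IsOptimal w f a) :
    IsOptimal w f b := by
  intro b' hb' hbb'
  -- A competitor `b'` of `b` gives the competitor `a + ε (b' - b)` of `a`: where `a` vanishes so
  -- does `b`, hence the increment is nonnegative there.
  obtain ⟨ε, hε, hpos⟩ := exists_pos_forall_add_mul_pos a (b' - b)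
  have h1 := h (a + ε • (b' - b)) (fun i => by
    rcases (ha i).lt_or_eq with hi | hi
    · exact (hpos i hi).le
    · have : ¬ 0 < b i := fun hb => (hab i hb).ne hi
      have h3 := hb' i
      simp only [Pi.add_apply, Pi.smul_apply, Pi.sub_apply, smul_eq_mul, ← hi]
      have : 0 ≤ b' i - b i := by linarith
      positivity) (by
    have := sum_add_mul_smul w a (b' - b) ε
    simp only [Pi.add_apply, Pi.smul_apply, Pi.sub_apply, smul_eq_mul] at this ⊢
    rw [this]
    simp [sub_smul, hbb'])
  simp only [map_add, map_smul, map_sub, smul_eq_mul] at h1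
  have : 0 ≤ ε * (f b' - f b) := by linarith
  have := nonneg_of_mul_nonneg_right this hε
  linarith

/-- For a generic functional, the supports of optimal coefficient vectors are independent. -/
theorem exists_generic_functional [AddCommGroup E] [Module ℝ E] (w : ι → E) :
    ∃ f : (ι → ℝ) →ₗ[ℝ] ℝ, ∀ a : ι → ℝ, (∀ i, 0 ≤ a i) → IsOptimal w f a →
      ∀ S : Finset ι, (∀ i ∈ S, 0 < a i) → IndepOn w S := by
  have hex : ∀ S : {S : Finset ι // ¬ IndepOn w S}, ∃ c : ι → ℝ,
      (∀ i ∉ S.1, c i = 0) ∧ ∑ i, c i • w i = 0 ∧ c ≠ 0 := by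
    rintro ⟨S, hS⟩
    simpa [IndepOn, not_forall] using hS
  choose c hc hcw hc0 using hex
  -- Generic means nonzero on one chosen linear relation for each of the finitely many dependent
  -- sets.
  obtain ⟨f, hf⟩ := Module.exists_dual_forall_apply_ne_zero (K := ℝ) c hc0
  refine ⟨f, fun a ha hopt S hS => ?_⟩
  by_contra hind
  -- The relation is supported where `a` is positive, so `a` can be moved along it in both
  -- directions; optimality then forces `f` to vanish on it.
  have key : ∀ s : ℝ, 0 ≤ s * f (c ⟨S, hind⟩) := by
    intro s
    obtain ⟨ε, hε, hpos⟩ := exists_pos_forall_add_mul_pos a (s • c ⟨S, hind⟩)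
    have h1 := hopt (a + ε • s • c ⟨S, hind⟩) (fun i => by
      by_cases hi : i ∈ S
      · exact (hpos i (hS i hi)).le
      · simpa [hc ⟨S, hind⟩ i hi] using ha i) (by
      have := sum_add_mul_smul w a (s • c ⟨S, hind⟩) ε
      simp only [Pi.add_apply, Pi.smul_apply, smul_eq_mul] at this ⊢
      rw [this]
      simp only [mul_smul, ← Finset.smul_sum, hcw, smul_zero, add_zero])
    simp only [map_add, map_smul, smul_eq_mul] at h1
    exact nonneg_of_mul_nonneg_right (by linarith) hε
  have h1 := key 1
  have h2 := key (-1)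
  exact hf ⟨S, hind⟩ (by linarith)

/-- The functional `u` fixes the sum of the coefficients, so the feasible set is compact and the
minimum is attained. -/
theorem exists_isOptimal [NormedAddCommGroup E] [NormedSpace ℝ E] (w : ι → E)
    (u : E →ₗ[ℝ] ℝ) (hu : ∀ i, u (w i) = 1) (f : (ι → ℝ) →ₗ[ℝ] ℝ) (c : ι → ℝ)
    (hc : ∀ i, 0 ≤ c i) :
    ∃ a : ι → ℝ, (∀ i, 0 ≤ a i) ∧ ∑ i, a i • w i = ∑ i, c i • w i ∧ IsOptimal w f a := by
  set K : Set (ι → ℝ) := {a | (∀ i, 0 ≤ a i) ∧ ∑ i, a i • w i = ∑ i, c i • w i} with hK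
  have hclosed : IsClosed K := by
    refine IsClosed.inter ?_ ?_
    · exact isClosed_Ici (a := (0 : ι → ℝ))
    · exact isClosed_eq (by fun_prop) continuous_const
  have hsum : ∀ a : ι → ℝ, u (∑ i, a i • w i) = ∑ i, a i := by
    intro a
    simp [map_sum, hu]
  have hcomp : IsCompact K := by
    refine (isCompact_Icc (a := (0 : ι → ℝ)) (b := fun _ => ∑ i, c i)).of_isClosed_subset
      hclosed ?_
    rintro a ⟨ha, haw⟩
    refine ⟨ha, fun i => ?_⟩
    have := congrArg u haw
    rw [hsum, hsum] at this
    rw [← this]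
    exact Finset.single_le_sum (fun j _ => ha j) (Finset.mem_univ i)
  obtain ⟨a, haK, hmin⟩ := hcomp.exists_isMinOn ⟨c, hc, rfl⟩
    f.continuous_of_finiteDimensional.continuousOn
  exact ⟨a, haK.1, haK.2, fun b hb hbw => hmin ⟨hb, hbw.trans haK.2⟩⟩

/-- The open cone on finitely many vectors is a disjoint union of open simplicial cones. -/
theorem exists_simplicial_partition [NormedAddCommGroup E] [NormedSpace ℝ E] (w : ι → E)
    (u : E →ₗ[ℝ] ℝ) (hu : ∀ i, u (w i) = 1) :
    ∃ 𝒯 : Finset (Finset ι), (∀ S ∈ 𝒯, IndepOn w S) ∧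
      (∀ S ∈ 𝒯, openCone w S ⊆ openCone w Finset.univ) ∧
      (∀ x ∈ openCone w Finset.univ, ∃ S ∈ 𝒯, x ∈ openCone w S) ∧
      (∀ S ∈ 𝒯, ∀ S' ∈ 𝒯, ∀ x, x ∈ openCone w S → x ∈ openCone w S' → S = S') := by
  classical
  obtain ⟨f, hf⟩ := exists_generic_functional w
  let p : Finset ι → Prop := fun S => ∃ a : ι → ℝ, (∀ i, 0 ≤ a i) ∧ (∀ i, i ∈ S ↔ 0 < a i) ∧
    IsOptimal w f a ∧ ∑ i, a i • w i ∈ openCone w Finset.univ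
  refine ⟨Finset.univ.filter p, ?_, ?_, ?_, ?_⟩
  · intro S hS
    obtain ⟨a, ha, haS, hopt, -⟩ := (Finset.mem_filter.1 hS).2
    exact hf a ha hopt S fun i hi => (haS i).1 hi
  · intro S hS x hx
    obtain ⟨a, ha, haS, -, c, hc, hcS, hca⟩ := (Finset.mem_filter.1 hS).2
    obtain ⟨b, hb, hbS, rfl⟩ := hx
    -- Trading `ε a` for `ε c`, which represents the same vector with all coefficients positive,
    -- makes every coefficient of `x` positive.
    obtain ⟨ε, hε, hpos⟩ := exists_pos_forall_add_mul_pos b (-a)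
    have hp : ∀ i, 0 < (b i + ε * (-a) i) + ε * c i := by
      intro i
      have h1 : 0 < c i := (hcS i).1 (Finset.mem_univ i)
      have h2 := mul_pos hε h1
      by_cases hi : i ∈ S
      · have := hpos i ((hbS i).1 hi)
        linarith
      · have h3 : a i = 0 := le_antisymm (not_lt.1 fun h => hi ((haS i).2 h)) (ha i)
        have := hb i
        simp only [Pi.neg_apply, h3]
        linarith
    refine ⟨_, fun i => (hp i).le, fun i => ⟨fun _ => hp i, fun _ => Finset.mem_univ i⟩, ?_⟩
    rw [sum_add_mul_smul w (fun i => b i + ε * (-a) i) c ε, sum_add_mul_smul w b (-a) ε, hca]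
    simp
  · rintro x ⟨c, hc, hcS, rfl⟩
    obtain ⟨a, ha, haw, hopt⟩ := exists_isOptimal w u hu f c hc
    refine ⟨Finset.univ.filter fun i => 0 < a i, Finset.mem_filter.2 ⟨Finset.mem_univ _,
      a, ha, by simp, hopt, haw ▸ ⟨c, hc, hcS, rfl⟩⟩, a, ha, by simp, haw⟩
  · intro S hS S' hS' x hx hx'
    obtain ⟨a, ha, haS, hopt, -⟩ := (Finset.mem_filter.1 hS).2
    obtain ⟨a', ha', haS', hopt', -⟩ := (Finset.mem_filter.1 hS').2
    obtain ⟨b, hb, hbS, hbx⟩ := hx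
    obtain ⟨b', hb', hbS', hbx'⟩ := hx'
    have hob : IsOptimal w f b := hopt.of_support ha fun i hi => (haS i).1 ((hbS i).2 hi)
    have hob' : IsOptimal w f b' := hopt'.of_support ha' fun i hi => (haS' i).1 ((hbS' i).2 hi)
    have heq : f b = f b' := le_antisymm (hob b' hb' (hbx'.trans hbx.symm))
      (hob' b hb (hbx.trans hbx'.symm))
    -- The midpoint of two optimal representations of `x` is optimal with support `S ∪ S'`, so that
    -- union is independent and `b = b'`.
    have hmid : IsOptimal w f ((1 / 2 : ℝ) • (b + b')) := by
      intro d hd hdw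
      have h1 : ∑ i, ((1 / 2 : ℝ) • (b + b')) i • w i = x := by
        simp only [Pi.smul_apply, Pi.add_apply, smul_eq_mul, mul_smul, ← Finset.smul_sum,
          add_smul, Finset.sum_add_distrib, hbx, hbx']
        rw [← two_smul ℝ x, smul_smul]
        norm_num
      have h2 := hob d hd (by rw [hdw, h1, hbx])
      simp only [map_smul, map_add, smul_eq_mul]
      linarith
    have hind := hf _ (fun i => by
      have := hb i
      have := hb' i
      simp only [Pi.smul_apply, Pi.add_apply, smul_eq_mul]
      positivity) hmid (S ∪ S') (fun i hi => by
      have h1 := hb i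
      have h2 := hb' i
      simp only [Pi.smul_apply, Pi.add_apply, smul_eq_mul]
      rcases Finset.mem_union.1 hi with h | h
      · have := (hbS i).1 h
        positivity
      · have := (hbS' i).1 h
        positivity)
    have h0 := hind (b - b') (fun i hi => by
      rw [Finset.mem_union, not_or, hbS, hbS'] at hi
      have h1 := hb i
      have h2 := hb' i
      simp only [Pi.sub_apply]
      linarith [not_lt.1 hi.1, not_lt.1 hi.2]) (by
      simp [sub_smul, hbx, hbx'])
    have h1 : b = b' := sub_eq_zero.1 h0
    ext i
    rw [hbS, hbS', h1]

end

/-! ### Relative interiors as slices of open cones. -/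

section
variable {ι E : Type*} [Fintype ι] [NormedAddCommGroup E] [NormedSpace ℝ E]

theorem mem_openCone_homogenize {v : ι → E} {x : E} {t : ℝ} :
    (x, t) ∈ openCone (fun i => (v i, (1 : ℝ))) Finset.univ ↔
      ∃ c : ι → ℝ, (∀ i, 0 < c i) ∧ ∑ i, c i = t ∧ ∑ i, c i • v i = x := by
  constructor
  · rintro ⟨c, -, hc, h⟩
    have h1 := congrArg Prod.fst h
    have h2 := congrArg Prod.snd h
    simp only [Prod.fst_sum, Prod.snd_sum, Prod.smul_fst, Prod.smul_snd, smul_eq_mul,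
      mul_one] at h1 h2
    exact ⟨c, fun i => (hc i).1 (Finset.mem_univ i), h2, h1⟩
  · rintro ⟨c, hc, h1, h2⟩
    refine ⟨c, fun i => (hc i).le, fun i => ⟨fun _ => hc i, fun _ => Finset.mem_univ i⟩, ?_⟩
    ext <;> simp [Prod.fst_sum, Prod.snd_sum, h1, h2]

theorem mem_convexHull_range {v : ι → E} {x : E} :
    x ∈ convexHull ℝ (Set.range v) ↔
      ∃ c : ι → ℝ, (∀ i, 0 ≤ c i) ∧ ∑ i, c i = 1 ∧ ∑ i, c i • v i = x := by
  constructor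
  · intro hx
    rw [convexHull_range_eq_exists_affineCombination] at hx
    obtain ⟨s, c, hc, h1, rfl⟩ := hx
    classical
    refine ⟨fun i => if i ∈ s then c i else 0, fun i => ?_, ?_, ?_⟩
    · dsimp only
      split_ifs with h
      exacts [hc i h, le_rfl]
    · simpa using h1
    · rw [Finset.affineCombination_eq_linear_combination _ _ _ h1]
      simp [ite_smul]
  · rintro ⟨c, hc, h1, rfl⟩
    exact (convex_convexHull ℝ _).sum_mem (fun i _ => hc i) h1
      fun i _ => subset_convexHull ℝ _ ⟨i, rfl⟩

/-- A relative interior point can be pushed slightly away from the barycentre within the hull, so it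
is a proper mixture of the barycentre and a point of the hull. Conversely, the coefficient map is
open onto its range, so the positive orthant has relatively open image. -/
theorem mem_intrinsicInterior_convexHull_range [Nonempty ι] {v : ι → E} {x : E} :
    x ∈ intrinsicInterior ℝ (convexHull ℝ (Set.range v)) ↔
      ∃ c : ι → ℝ, (∀ i, 0 < c i) ∧ ∑ i, c i = 1 ∧ ∑ i, c i • v i = x := by
  constructor
  · intro hx
    obtain ⟨⟨x', hxA⟩, hxi, rfl⟩ := mem_intrinsicInterior.1 hx
    set N : ℝ := (Fintype.card ι : ℝ) with hN
    have hNpos : 0 < N := by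
      rw [hN]
      exact_mod_cast Fintype.card_pos
    set b : E := ∑ i, (1 / N) • v i with hb
    have hbA : b ∈ affineSpan ℝ (convexHull ℝ (Set.range v)) := by
      refine subset_affineSpan ℝ _ (mem_convexHull_range.2 ⟨fun _ => 1 / N, fun _ => by positivity,
        ?_, rfl⟩)
      simp [← hN, hNpos.ne']
    let γ : ℝ → affineSpan ℝ (convexHull ℝ (Set.range v)) := fun t =>
      ⟨AffineMap.lineMap b x' t, AffineMap.lineMap_mem t hbA hxA⟩
    have hγ : Continuous γ := by
      refine Continuous.subtype_mk ?_ _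
      exact AffineMap.lineMap_continuous
    have h1 : γ 1 = ⟨x', hxA⟩ := by simp [γ]
    have h2 : ∀ᶠ t in nhds (1 : ℝ), γ t ∈ interior ((↑) ⁻¹' (convexHull ℝ (Set.range v)) :
        Set (affineSpan ℝ (convexHull ℝ (Set.range v)))) :=
      hγ.continuousAt.eventually (isOpen_interior.mem_nhds (h1 ▸ hxi))
    obtain ⟨t, ht, ht1⟩ := ((h2.filter_mono nhdsWithin_le_nhds).and
      (self_mem_nhdsWithin (s := Set.Ioi (1 : ℝ)))).exists
    have ht1 : 1 < t := ht1
    have h3 : AffineMap.lineMap b x' t ∈ convexHull ℝ (Set.range v) := by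
      have h4 := interior_subset ht
      exact h4
    obtain ⟨c, hc, hc1, hcx⟩ := mem_convexHull_range.1 h3
    have hδ : 0 < 1 - t⁻¹ := by
      have := inv_lt_one_of_one_lt₀ ht1
      linarith
    refine ⟨fun i => t⁻¹ * c i + (1 - t⁻¹) * (1 / N), fun i => ?_, ?_, ?_⟩
    · have := hc i
      positivity
    · rw [Finset.sum_add_distrib, ← Finset.mul_sum, hc1, Finset.sum_const, Finset.card_univ,
        nsmul_eq_mul, ← hN]
      field_simp
      ring
    · simp only [add_smul, mul_smul, Finset.sum_add_distrib, ← Finset.smul_sum]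
      rw [hcx, Finset.smul_sum, ← hb, AffineMap.lineMap_apply_module]
      have : t ≠ 0 := by positivity
      rw [smul_add, smul_smul, smul_smul, inv_mul_cancel₀ this, one_smul, add_right_comm,
        ← add_smul, mul_sub, inv_mul_cancel₀ this]
      simp
  · rintro ⟨c, hc, hc1, hcx⟩
    have hxC : x ∈ convexHull ℝ (Set.range v) :=
      mem_convexHull_range.2 ⟨c, fun i => (hc i).le, hc1, hcx⟩
    let L : (ι → ℝ) →ₗ[ℝ] E × ℝ :=
      { toFun := fun a => (∑ i, a i • v i, ∑ i, a i)
        map_add' := fun a b => by simp [add_smul, Finset.sum_add_distrib]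
        map_smul' := fun r a => by simp [mul_smul, Finset.smul_sum, Finset.mul_sum] }
    have hopen : IsOpenMap L.rangeRestrict :=
      LinearMap.isOpenMap_of_finiteDimensional _ L.surjective_rangeRestrict
    have hU : IsOpen {a : ι → ℝ | ∀ i, 0 < a i} := by
      simp only [Set.ofPred_forall]
      exact isOpen_iInter_of_finite fun i => isOpen_lt continuous_const (continuous_apply i)
    have hmem : ∀ y : affineSpan ℝ (convexHull ℝ (Set.range v)),
        ((y : E), (1 : ℝ)) ∈ LinearMap.range L := by
      rintro ⟨y, hy⟩
      rw [affineSpan_convexHull] at hy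
      obtain ⟨a, ha1, hay⟩ := eq_affineCombination_of_mem_affineSpan_of_fintype hy
      rw [Finset.affineCombination_eq_linear_combination _ _ _ ha1] at hay
      exact ⟨a, Prod.ext hay.symm ha1⟩
    let g : affineSpan ℝ (convexHull ℝ (Set.range v)) → LinearMap.range L :=
      fun y => ⟨((y : E), (1 : ℝ)), hmem y⟩
    have hg : Continuous g := by
      refine Continuous.subtype_mk ?_ _
      fun_prop
    refine mem_intrinsicInterior.2 ⟨⟨x, subset_affineSpan ℝ _ hxC⟩, ?_, rfl⟩
    refine mem_interior.2 ⟨g ⁻¹' (L.rangeRestrict '' {a : ι → ℝ | ∀ i, 0 < a i}), ?_,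
      (hopen _ hU).preimage hg, ⟨c, hc, Subtype.ext (Prod.ext hcx hc1)⟩⟩
    rintro y ⟨a, ha, hay⟩
    have h1 := congrArg Subtype.val hay
    exact mem_convexHull_range.2 ⟨a, fun i => (ha i).le, congrArg Prod.snd h1,
      congrArg Prod.fst h1⟩

theorem mem_intrinsicInterior_smul_convexHull_range [Nonempty ι] {v : ι → E} {x : E} {t : ℝ}
    (ht : 0 < t) :
    x ∈ intrinsicInterior ℝ (t • convexHull ℝ (Set.range v)) ↔
      (x, t) ∈ openCone (fun i => (v i, (1 : ℝ))) Finset.univ := by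
  rw [← convexHull_smul, Set.smul_set_range, mem_intrinsicInterior_convexHull_range,
    mem_openCone_homogenize]
  constructor
  · rintro ⟨c, hc, h1, h2⟩
    refine ⟨fun i => t * c i, fun i => mul_pos ht (hc i), ?_, ?_⟩
    · rw [← Finset.mul_sum, h1, mul_one]
    · rw [← h2]
      exact Finset.sum_congr rfl fun i _ => by simp only [smul_smul, mul_comm]
  · rintro ⟨c, hc, h1, h2⟩
    refine ⟨fun i => t⁻¹ * c i, fun i => mul_pos (inv_pos.2 ht) (hc i), ?_, ?_⟩
    · rw [← Finset.mul_sum, h1, inv_mul_cancel₀ ht.ne']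
    · rw [← h2]
      exact Finset.sum_congr rfl fun i _ => by
        rw [smul_smul, mul_right_comm, inv_mul_cancel₀ ht.ne', one_mul]
end

/-! ### Polynomial sequences and their convolutions. -/

open Polynomial in
theorem exists_polynomial_sum_range_pow (d : ℕ) :
    ∃ F : ℂ[X], ∀ M : ℕ, F.eval (M : ℂ) = ∑ j ∈ Finset.range M, (j : ℂ) ^ d := by
  refine ⟨∑ i ∈ Finset.range (d + 1),
    C (((_root_.bernoulli i * ((d + 1).choose i) / (d + 1) : ℚ) : ℂ)) * X ^ (d + 1 - i), fun M => ?_⟩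
  have h := congrArg (Rat.cast : ℚ → ℂ) (sum_range_pow M d)
  push_cast at h
  rw [h, eval_finsetSum]
  refine Finset.sum_congr rfl fun i _ => ?_
  simp only [eval_mul, eval_C, eval_pow, eval_X]
  push_cast
  ring

open Polynomial in
theorem exists_polynomial_convolution (p q : ℂ[X]) :
    ∃ F : ℂ[X], ∀ M : ℕ,
      F.eval (M : ℂ) = ∑ j ∈ Finset.range M, p.eval (j : ℂ) * q.eval ((M : ℂ) - 1 - j) := by
  choose S hS using exists_polynomial_sum_range_pow
  -- The outer variable is the summation index and the inner one stands for `M`; expanding in the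
  -- outer variable leaves power sums.
  set R : ℂ[X][X] := p.map C * (q.map C).comp (C (X - 1) - X) with hR
  refine ⟨∑ i ∈ Finset.range (R.natDegree + 1), R.coeff i * S i, fun M => ?_⟩
  have hRe : ∀ y : ℂ, p.eval y * q.eval ((M : ℂ) - 1 - y) =
      ∑ i ∈ Finset.range (R.natDegree + 1), (R.coeff i).eval (M : ℂ) * y ^ i := by
    intro y
    have h1 : (R.eval (C y)).eval (M : ℂ) = p.eval y * q.eval ((M : ℂ) - 1 - y) := by
      simp only [hR, eval_mul, eval_comp, eval_sub, eval_C, eval_X, eval_map]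
      rw [eval₂_hom, eval_C]
      congr 1
      change eval _ (q.comp (X - 1 - C y)) = _
      simp [eval_comp]
    rw [← h1, eval_eq_sum_range (p := R), eval_finsetSum]
    simp [eval_mul]
  simp only [hRe]
  rw [Finset.sum_comm, eval_finsetSum]
  refine Finset.sum_congr rfl fun i _ => ?_
  rw [eval_mul, hS, Finset.mul_sum]

open PowerSeries in
/-- The product of finitely many generating functions `∑_{k ≥ 0} q(k) X^(k+1)` of polynomial
sequences is again of that form. -/
theorem exists_polynomial_prod {ι : Type*} (q : ι → Polynomial ℂ) {S : Finset ι}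
    (hS : S.Nonempty) :
    ∃ F : Polynomial ℂ, ∏ i ∈ S, (X * PowerSeries.mk fun k => (q i).eval (k : ℂ)) =
      X * PowerSeries.mk fun k => F.eval (k : ℂ) := by
  induction hS using Finset.Nonempty.cons_induction with
  | singleton a => exact ⟨q a, by simp⟩
  | cons a s ha hs ih =>
    obtain ⟨F, hF⟩ := ih
    obtain ⟨G, hG⟩ := exists_polynomial_convolution (q a) F
    refine ⟨G, ?_⟩
    rw [Finset.prod_cons, hF, mul_assoc]
    congr 1
    ext M
    rw [mul_left_comm, coeff_mk, hG]
    cases M with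
    | zero => simp
    | succ M =>
      rw [coeff_succ_X_mul, coeff_mul, Finset.Nat.sum_antidiagonal_eq_sum_range_succ_mk]
      refine Finset.sum_congr rfl fun j hj => ?_
      have hj : j ≤ M := Nat.lt_succ_iff.1 (Finset.mem_range.1 hj)
      simp only [coeff_mk]
      congr 2
      push_cast [hj]
      ring

/-- Both clauses read off the coefficient of `X ^ (M + 1)` in `X ^ |S|` times a product of power
series; it is zero below degree `|S|`. -/
theorem exists_polynomial_sum_prod {ι : Type*} [DecidableEq ι] (q : ι → Polynomial ℂ)
    {S : Finset ι} (hS : S.Nonempty) :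
    ∃ F : Polynomial ℂ,
      (∀ M N : ℕ, N + S.card = M + 1 →
        ∑ k ∈ S.finsuppAntidiag N, ∏ i ∈ S, (q i).eval (k i : ℂ) = F.eval (M : ℂ)) ∧
      ∀ M : ℕ, M + 1 < S.card → F.eval (M : ℂ) = 0 := by
  obtain ⟨F, hF⟩ := exists_polynomial_prod q hS
  have h : ∀ M : ℕ, PowerSeries.coeff (M + 1)
      (PowerSeries.X ^ S.card * ∏ i ∈ S, PowerSeries.mk fun k => (q i).eval (k : ℂ)) =
      F.eval (M : ℂ) := by
    intro M
    rw [← Finset.prod_const, ← Finset.prod_mul_distrib, hF, PowerSeries.coeff_succ_X_mul,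
      PowerSeries.coeff_mk]
  refine ⟨F, fun M N hMN => ?_, fun M hM => ?_⟩
  · rw [← h, ← hMN, PowerSeries.coeff_X_pow_mul, PowerSeries.coeff_prod]
    simp
  · rw [← h, PowerSeries.coeff_X_pow_mul', if_neg (by lia)]

/-- The sum of a polynomial over the compositions of `N` indexed by `S` is a polynomial in `N`
that vanishes at the negative integers above `-|S|`. -/
theorem exists_polynomial_sum_finsuppAntidiag {ι : Type*} [Fintype ι] [DecidableEq ι]
    {S : Finset ι} (hS : S.Nonempty) (φ : MvPolynomial ι ℂ) :
    ∃ F : Polynomial ℂ,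
      (∀ M N : ℕ, N + S.card = M + 1 →
        ∑ k ∈ S.finsuppAntidiag N, MvPolynomial.eval (fun i => (k i : ℂ)) φ = F.eval (M : ℂ)) ∧
      ∀ M : ℕ, M + 1 < S.card → F.eval (M : ℂ) = 0 := by
  induction φ using MvPolynomial.induction_on' with
  | monomial s a =>
    obtain ⟨F, hF, hF0⟩ := exists_polynomial_sum_prod (fun i => Polynomial.X ^ s i) hS
    -- Compositions vanish off `S`; with `0 ^ 0 = 1`, this factor kills exactly the monomials
    -- involving other variables.
    refine ⟨Polynomial.C (a * ∏ i ∈ Sᶜ, 0 ^ s i) * F, fun M N hMN => ?_, fun M hM => ?_⟩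
    · rw [Polynomial.eval_mul, Polynomial.eval_C, ← hF M N hMN, Finset.mul_sum]
      refine Finset.sum_congr rfl fun k hk => ?_
      have hk := (Finset.mem_finsuppAntidiag.1 hk).2
      rw [MvPolynomial.eval_monomial, Finsupp.prod_fintype _ _ (fun i => by simp), mul_assoc,
        ← Finset.prod_compl_mul_prod S]
      congr 2
      · refine Finset.prod_congr rfl fun i hi => ?_
        have : k i = 0 := by
          by_contra h
          exact Finset.mem_compl.1 hi (hk (Finsupp.mem_support_iff.2 h))
        simp [this]
      · simp
    · rw [Polynomial.eval_mul, hF0 M hM, mul_zero]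
  | add p q hp hq =>
    obtain ⟨F, hF, hF0⟩ := hp
    obtain ⟨G, hG, hG0⟩ := hq
    refine ⟨F + G, fun M N hMN => ?_, fun M hM => ?_⟩
    · simp only [map_add, Finset.sum_add_distrib, hF M N hMN, hG M N hMN, Polynomial.eval_add]
    · rw [Polynomial.eval_add, hF0 M hM, hG0 M hM, add_zero]

/-! ### Lattice points in simplicial cones. -/

section
variable {n : ℕ} {ι : Type*} [Fintype ι]

/-- The vectors `(v i, 1)` of `ℝⁿ × ℝ`. -/
def homogenize (v : ι → Fin n → ℤ) (i : ι) : (Fin n → ℝ) × ℝ := (latticeVec (v i), 1)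

theorem sum_smul_homogenize {v : ι → Fin n → ℤ} {c : ι → ℝ} {m : Fin n → ℤ} {l : ℝ} :
    ∑ i, c i • homogenize v i = (latticeVec m, l) ↔
      (∀ j, ∑ i, c i * (v i j : ℝ) = m j) ∧ ∑ i, c i = l := by
  rw [Prod.ext_iff, funext_iff]
  simp [homogenize, latticeVec, Prod.fst_sum, Prod.snd_sum, Finset.sum_apply]

/-- The data of a lattice point `b` and a height `h` such that `(b, h)` is a combination of the
vectors `(v i, 1)`, `i ∈ S`, with coefficients in `(0, 1]`. -/
def boxPoints (v : ι → Fin n → ℤ) (S : Finset ι) : Set ((Fin n → ℤ) × ℕ) :=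
  {x | ∃ r : ι → ℝ, (∀ i ∈ S, 0 < r i ∧ r i ≤ 1) ∧ (∀ i ∉ S, r i = 0) ∧
    ∑ i, r i • homogenize v i = (latticeVec x.1, (x.2 : ℝ))}

theorem finite_boxPoints (v : ι → Fin n → ℤ) (S : Finset ι) : (boxPoints v S).Finite := by
  refine ((Set.finite_Icc (fun j => -∑ i, |v i j|) (fun j => ∑ i, |v i j|)).prod
    (Set.finite_Iic (Fintype.card ι))).subset ?_
  rintro ⟨b, h⟩ ⟨r, hr, hr0, hrb⟩
  obtain ⟨h1, h2⟩ := sum_smul_homogenize.1 hrb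
  have h01 : ∀ i, 0 ≤ r i ∧ r i ≤ 1 := by
    intro i
    by_cases hi : i ∈ S
    · exact ⟨(hr i hi).1.le, (hr i hi).2⟩
    · simp [hr0 i hi]
  have hb : ∀ j, |b j| ≤ ∑ i, |v i j| := by
    intro j
    have : |(b j : ℝ)| ≤ ∑ i, |(v i j : ℝ)| := by
      rw [← h1 j]
      refine (Finset.abs_sum_le_sum_abs _ _).trans (Finset.sum_le_sum fun i _ => ?_)
      rw [abs_mul, abs_of_nonneg (h01 i).1]
      exact mul_le_of_le_one_left (abs_nonneg _) (h01 i).2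
    exact_mod_cast this
  refine ⟨⟨fun j => (abs_le.1 (hb j)).1, fun j => (abs_le.1 (hb j)).2⟩, ?_⟩
  have : (h : ℝ) ≤ Fintype.card ι := by
    simp only at h2
    rw [← h2]
    refine (Finset.sum_le_sum fun i _ => (h01 i).2).trans ?_
    simp
  exact_mod_cast this

theorem height_le_of_mem_boxPoints {v : ι → Fin n → ℤ} {S : Finset ι} {x : (Fin n → ℤ) × ℕ}
    (hx : x ∈ boxPoints v S) : x.2 ≤ S.card ∧ (S.Nonempty → 0 < x.2) := by
  obtain ⟨r, hr, hr0, hrb⟩ := hx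
  have h2 := (sum_smul_homogenize.1 hrb).2
  rw [← Finset.sum_subset (Finset.subset_univ S) fun i _ hi => hr0 i hi] at h2
  constructor
  · have : (x.2 : ℝ) ≤ S.card := by
      rw [← h2]
      refine (Finset.sum_le_sum fun i hi => (hr i hi).2).trans ?_
      simp
    exact_mod_cast this
  · intro hS
    have : (0 : ℝ) < x.2 := by
      rw [← h2]
      exact Finset.sum_pos (fun i hi => (hr i hi).1) hS
    exact_mod_cast this

theorem sub_mem_Ioc_unique {r r' : ℝ} {k k' : ℕ} (hr : 0 < r ∧ r ≤ 1) (hr' : 0 < r' ∧ r' ≤ 1)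
    (h : r + k = r' + k') : k = k' := by
  have h1 : (k : ℝ) < k' + 1 := by linarith
  have h2 : (k' : ℝ) < k + 1 := by linarith
  have h1 : k < k' + 1 := by exact_mod_cast h1
  have h2 : k' < k + 1 := by exact_mod_cast h2
  lia

/-- The remainder lies in `(0, 1]`, not `[0, 1)`, to match the strictly positive coefficients of an
open cone. -/
theorem exists_nat_add_mem_Ioc {c : ℝ} (hc : 0 < c) :
    ∃ k : ℕ, 0 < c - k ∧ c - k ≤ 1 := by
  have h1 := Nat.ceil_lt_add_one hc.le
  have h2 := Nat.le_ceil c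
  have h3 : 0 < ⌈c⌉₊ := Nat.ceil_pos.2 hc
  refine ⟨⌈c⌉₊ - 1, ?_, ?_⟩ <;> push_cast [Nat.one_le_iff_ne_zero.2 h3.ne'] <;> linarith

theorem eq_zero_of_mem_finsuppAntidiag {κ : Type*} [DecidableEq κ] {S : Finset κ} {N : ℕ}
    {k : κ →₀ ℕ} (hk : k ∈ S.finsuppAntidiag N) : ∀ i ∉ S, k i = 0 := by
  intro i hi
  by_contra h
  exact hi ((Finset.mem_finsuppAntidiag.1 hk).2 (Finsupp.mem_support_iff.2 h))

theorem sum_add_smul_homogenize [DecidableEq ι] {v : ι → Fin n → ℤ} {S : Finset ι} {r : ι → ℝ}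
    {b : Fin n → ℤ} {h l : ℕ} {k : ι →₀ ℕ}
    (hrb : ∑ i, r i • homogenize v i = (latticeVec b, (h : ℝ)))
    (hk : k ∈ S.finsuppAntidiag (l - h)) (hhl : h ≤ l) :
    ∑ i, (r i + k i) • homogenize v i =
      (latticeVec fun j => b j + ∑ i, v i j * (k i : ℤ), (l : ℝ)) := by
  obtain ⟨h1, h2⟩ := sum_smul_homogenize.1 hrb
  refine sum_smul_homogenize.2 ⟨fun j => ?_, ?_⟩
  · push_cast
    simp only [add_mul, Finset.sum_add_distrib, h1 j]
    exact congrArg _ (Finset.sum_congr rfl fun i _ => mul_comm _ _)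
  · have h3 : ∑ i, k i = l - h := by
      rw [← (Finset.mem_finsuppAntidiag.1 hk).1]
      exact (Finset.sum_subset (Finset.subset_univ S) fun i _ hi =>
        eq_zero_of_mem_finsuppAntidiag hk i hi).symm
    have h4 : ((∑ i, k i : ℕ) : ℝ) = l - h := by
      rw [h3, Nat.cast_sub hhl]
    push_cast at h4
    rw [Finset.sum_add_distrib, h2, h4]
    ring

/-- Ehrhart's theorem, with polynomial weights, for relatively open lattice simplices. -/
theorem exists_polynomial_sum_openCone (v : ι → Fin n → ℤ) {S : Finset ι}
    (hS : IndepOn (homogenize v) S) (φ : MvPolynomial (Fin n) ℂ) :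
    ∃ F : Polynomial ℂ, ∀ l : ℕ, 0 < l → ∀ A : Finset (Fin n → ℤ),
      (∀ m, m ∈ A ↔ (latticeVec m, (l : ℝ)) ∈ openCone (homogenize v) S) →
      ∑ m ∈ A, MvPolynomial.eval (fun j => (m j : ℂ)) φ = F.eval (l : ℂ) := by
  classical
  rcases S.eq_empty_or_nonempty with rfl | hne
  · refine ⟨0, fun l hl A hA => ?_⟩
    rw [Polynomial.eval_zero]
    refine Finset.sum_eq_zero fun m hm => ?_
    obtain ⟨c, hc, hcS, hcm⟩ := (hA m).1 hm
    have h2 := (sum_smul_homogenize.1 hcm).2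
    have h3 : ∀ i, c i = 0 := fun i =>
      le_antisymm (not_lt.1 fun h => Finset.notMem_empty i ((hcS i).2 h)) (hc i)
    simp only [h3, Finset.sum_const_zero] at h2
    exact absurd (by exact_mod_cast h2.symm) hl.ne'
  -- The weight `φ` pulled back along `k ↦ b + ∑ k i • v i`.
  · let ψ : (Fin n → ℤ) → MvPolynomial ι ℂ := fun b => MvPolynomial.bind₁
      (fun j => MvPolynomial.C (b j : ℂ) +
        ∑ i, MvPolynomial.C (v i j : ℂ) * MvPolynomial.X i) φ
    have hψ : ∀ b (k : ι → ℕ), MvPolynomial.eval (fun i => (k i : ℂ)) (ψ b) =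
        MvPolynomial.eval (fun j => ((b j + ∑ i, v i j * (k i : ℤ) : ℤ) : ℂ)) φ := by
      intro b k
      simp only [ψ, ← MvPolynomial.coe_aeval_eq_eval, RingHom.coe_coe,
        MvPolynomial.aeval_bind₁]
      congr 2
      ext j
      simp
    choose F hF hF0 using fun b => exists_polynomial_sum_finsuppAntidiag hne (ψ b)
    set B := (finite_boxPoints v S).toFinset with hB
    -- Compositions of `N = l - h` are counted at `M = N + |S| - 1`. Since `h ≤ |S|` and `l > 0`,
    -- this `M` is a natural number even when `N < 0`, and there `F` vanishes.
    refine ⟨∑ x ∈ B, (F x.1).comp (Polynomial.X + Polynomial.C ((S.card : ℂ) - 1 - x.2)),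
      fun l hl A hA => ?_⟩
    have hfib : ∀ x ∈ B, ((F x.1).comp
        (Polynomial.X + Polynomial.C ((S.card : ℂ) - 1 - x.2))).eval (l : ℂ) =
        if x.2 ≤ l then ∑ k ∈ S.finsuppAntidiag (l - x.2),
          MvPolynomial.eval (fun i => (k i : ℂ)) (ψ x.1) else 0 := by
      intro x hx
      obtain ⟨h1, h2⟩ := height_le_of_mem_boxPoints ((finite_boxPoints v S).mem_toFinset.1 hx)
      obtain ⟨M, hM⟩ : ∃ M, M + 1 + x.2 = l + S.card := ⟨l + S.card - 1 - x.2, by lia⟩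
      have hMc : (l : ℂ) + ((S.card : ℂ) - 1 - x.2) = M := by
        have : (M : ℂ) + 1 + x.2 = l + S.card := by exact_mod_cast hM
        linear_combination -this
      rw [Polynomial.eval_comp, Polynomial.eval_add, Polynomial.eval_X, Polynomial.eval_C, hMc]
      split_ifs with h
      · exact (hF x.1 M (l - x.2) (by lia)).symm
      · exact hF0 x.1 M (by lia)
    rw [Polynomial.eval_finsetSum, Finset.sum_congr rfl hfib, ← Finset.sum_filter,
      Finset.sum_sigma']
    symm
    refine Finset.sum_nbij (fun y => fun j => y.1.1 j + ∑ i, v i j * (y.2 i : ℤ)) ?_ ?_ ?_ ?_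
    · rintro ⟨⟨b, h⟩, k⟩ hy
      simp only [Finset.mem_sigma, Finset.mem_filter, hB, Set.Finite.mem_toFinset] at hy
      obtain ⟨⟨⟨r, hr, hr0, hrb⟩, hhl⟩, hk⟩ := hy
      have hk0 := eq_zero_of_mem_finsuppAntidiag hk
      refine (hA _).2 ⟨fun i => r i + k i, fun i => ?_, fun i => ?_,
        sum_add_smul_homogenize hrb hk hhl⟩
      · by_cases hi : i ∈ S
        · have := (hr i hi).1
          positivity
        · simp [hr0 i hi]
      · by_cases hi : i ∈ S
        · have := (hr i hi).1
          simp only [hi, true_iff]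
          positivity
        · simp [hi, hr0 i hi, hk0 i hi]
    · rintro ⟨⟨b, h⟩, k⟩ hy ⟨⟨b', h'⟩, k'⟩ hy' hm
      simp only [Finset.coe_sigma, Set.mem_sigma_iff, Finset.mem_coe, Finset.mem_filter, hB,
        Set.Finite.mem_toFinset] at hy hy'
      obtain ⟨⟨⟨r, hr, hr0, hrb⟩, hhl⟩, hk⟩ := hy
      obtain ⟨⟨⟨r', hr', hr0', hrb'⟩, hhl'⟩, hk'⟩ := hy'
      have hk0 := eq_zero_of_mem_finsuppAntidiag hk
      have hk0' := eq_zero_of_mem_finsuppAntidiag hk'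
      have e1 := sum_add_smul_homogenize hrb hk hhl
      have e2 := sum_add_smul_homogenize hrb' hk' hhl'
      dsimp only at hm e1 e2 hk hk' hhl hhl'
      rw [hm, ← e2, ← sub_eq_zero, ← Finset.sum_sub_distrib] at e1
      simp only [← sub_smul] at e1
      -- Independence equates the full coefficients `r + k` and `r' + k'`; remainders in `(0, 1]`
      -- then determine the integral parts.
      have h0 := hS _ (fun i hi => by simp [hr0 i hi, hr0' i hi, hk0 i hi, hk0' i hi]) e1
      have hkk : k = k' := by
        ext i
        by_cases hi : i ∈ S
        · exact sub_mem_Ioc_unique (hr i hi) (hr' i hi) (sub_eq_zero.1 (congrFun h0 i))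
        · rw [hk0 i hi, hk0' i hi]
      subst hkk
      have hbb : b = b' := by
        ext j
        simpa using congrFun hm j
      have hhh : h = h' := by
        have h1 := (Finset.mem_finsuppAntidiag.1 hk).1
        have h2 := (Finset.mem_finsuppAntidiag.1 hk').1
        lia
      rw [hbb, hhh]
    · intro m hm
      obtain ⟨c, hc, hcS, hcm⟩ := (hA m).1 hm
      obtain ⟨h1, h2⟩ := sum_smul_homogenize.1 hcm
      have hex : ∀ i, ∃ k : ℕ, (i ∈ S → 0 < c i - k ∧ c i - k ≤ 1) ∧ (i ∉ S → k = 0) := by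
        intro i
        by_cases hi : i ∈ S
        · obtain ⟨k, hk⟩ := exists_nat_add_mem_Ioc ((hcS i).1 hi)
          exact ⟨k, fun _ => hk, fun h => absurd hi h⟩
        · exact ⟨0, fun h => absurd h hi, fun _ => rfl⟩
      choose k hkS hk0 using hex
      have hc0 : ∀ i ∉ S, c i = 0 := fun i hi =>
        le_antisymm (not_lt.1 fun h => hi ((hcS i).2 h)) (hc i)
      have hkle : ∑ i, k i ≤ l := by
        have : ((∑ i, k i : ℕ) : ℝ) ≤ l := by
          push_cast
          rw [← h2]
          refine Finset.sum_le_sum fun i _ => ?_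
          by_cases hi : i ∈ S
          · linarith [(hkS i hi).1]
          · simp [hk0 i hi, hc0 i hi]
        exact_mod_cast this
      refine ⟨⟨(fun j => m j - ∑ i, v i j * (k i : ℤ), l - ∑ i, k i),
        Finsupp.equivFunOnFinite.symm k⟩, ?_, by simp⟩
      simp only [Finset.coe_sigma, Set.mem_sigma_iff, Finset.mem_coe, Finset.mem_filter, hB,
        Set.Finite.mem_toFinset]
      refine ⟨⟨⟨fun i => c i - k i, fun i hi => hkS i hi,
        fun i hi => by simp [hk0 i hi, hc0 i hi], sum_smul_homogenize.2 ⟨fun j => ?_, ?_⟩⟩,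
        Nat.sub_le _ _⟩, ?_⟩
      · push_cast
        rw [← h1 j, ← Finset.sum_sub_distrib]
        exact Finset.sum_congr rfl fun i _ => by ring
      · push_cast [hkle]
        rw [← h2, ← Finset.sum_sub_distrib]
      · rw [Finset.mem_finsuppAntidiag, Nat.sub_sub_self hkle]
        refine ⟨?_, fun i hi => ?_⟩
        · exact Finset.sum_subset (Finset.subset_univ S) fun i _ hi => hk0 i hi
        · by_contra h
          exact Finsupp.mem_support_iff.1 hi (hk0 i h)
    · rintro ⟨⟨b, h⟩, k⟩ hy
      exact hψ b k
end

/-! ### Faces of a lattice polytope and assembly. -/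

/-- By Krein–Milman a face is the closed hull of its extreme points, which are extreme in `P` and
hence among its finitely many lattice generators; finiteness makes the closure superfluous. -/
theorem LatticePolytope.Face.exists_eq_convexHull_range {n : ℕ} {P : LatticePolytope n}
    (Q : P.Face) : ∃ (V : Finset (Fin n → ℤ)), V.Nonempty ∧
      Q.carrier = convexHull ℝ (Set.range fun m : V => latticeVec m.1) := by
  obtain ⟨V, hV⟩ := P.isHull
  have hsub : Q.1.extremePoints ℝ ⊆ latticeVec '' (V : Set (Fin n → ℤ)) := by
    refine Q.2.2.isExtreme.extremePoints_subset_extremePoints.trans ?_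
    rw [hV]
    exact extremePoints_convexHull_subset
  have hfin : (Q.1.extremePoints ℝ).Finite := (V.finite_toSet.image latticeVec).subset hsub
  have hQ : convexHull ℝ (Q.1.extremePoints ℝ) = Q.1 := by
    rw [← (hfin.isCompact_convexHull (𝕜 := ℝ)).isClosed.closure_eq]
    exact closure_convexHull_extremePoints (Q.2.2.isCompact P.isCompact) (Q.2.2.convex P.convex)
  obtain ⟨W, -, hW⟩ := Set.subset_image_iff.1 hsub
  obtain ⟨W', rfl⟩ : ∃ W' : Finset (Fin n → ℤ), (W' : Set (Fin n → ℤ)) = W := by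
    have hinj : Function.Injective (latticeVec (n := n)) := fun a b h => by
      ext j
      have := congrFun h j
      simpa [latticeVec] using this
    exact ((hW ▸ hfin).of_finite_image hinj.injOn).exists_finset_coe
  refine ⟨W', ?_, ?_⟩
  · obtain ⟨x, hx⟩ := Q.2.1
    rw [← hQ, ← hW] at hx
    simpa using convexHull_nonempty_iff.1 ⟨x, hx⟩
  · rw [LatticePolytope.Face.carrier, ← hQ, ← hW]
    congr 1
    ext
    simp

/-- Ehrhart's theorem, with polynomial weights, for the relative interior of a face. -/
theorem LatticePolytope.Face.exists_polynomial_relintSum {n : ℕ} {P : LatticePolytope n}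
    (Q : P.Face) (φ : MvPolynomial (Fin n) ℂ) :
    ∃ F : Polynomial ℂ, ∀ l : ℕ, 0 < l → Q.relintSum φ l = F.eval (l : ℂ) := by
  classical
  obtain ⟨V, hVne, hV⟩ := Q.exists_eq_convexHull_range
  have : Nonempty V := hVne.to_subtype
  let v : V → Fin n → ℤ := Subtype.val
  obtain ⟨𝒯, hind, hsub, hcov, hdisj⟩ := exists_simplicial_partition (homogenize v)
    (LinearMap.snd ℝ (Fin n → ℝ) ℝ) (fun _ => rfl)
  have hmem : ∀ l : ℕ, 0 < l → ∀ m, m ∈ Q.relintPoints l ↔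
      (latticeVec m, (l : ℝ)) ∈ openCone (homogenize v) Finset.univ := by
    intro l hl m
    rw [LatticePolytope.Face.relintPoints, Set.Finite.mem_toFinset, Set.mem_ofPred_eq, hV]
    exact mem_intrinsicInterior_smul_convexHull_range (by exact_mod_cast hl)
  choose! F hF using fun S (hS : S ∈ 𝒯) => exists_polynomial_sum_openCone v (hind S hS) φ
  refine ⟨∑ S ∈ 𝒯, F S, fun l hl => ?_⟩
  let A : Finset V → Finset (Fin n → ℤ) := fun S =>
    (Q.relintPoints l).filter fun m => (latticeVec m, (l : ℝ)) ∈ openCone (homogenize v) S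
  have hA : Q.relintPoints l = 𝒯.biUnion A := by
    ext m
    simp only [A, Finset.mem_biUnion, Finset.mem_filter]
    constructor
    · intro hm
      obtain ⟨S, hS, hmS⟩ := hcov _ ((hmem l hl m).1 hm)
      exact ⟨S, hS, hm, hmS⟩
    · rintro ⟨S, -, hm, -⟩
      exact hm
  rw [LatticePolytope.Face.relintSum, hA, Finset.sum_biUnion, Polynomial.eval_finsetSum]
  · refine Finset.sum_congr rfl fun S hS => hF S hS l hl _ fun m => ?_
    simp only [A, Finset.mem_filter, hmem l hl, and_iff_right_iff_imp]
    exact fun h => hsub S hS h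
  · intro S hS S' hS' hne
    refine Finset.disjoint_left.2 fun m hm hm' => hne ?_
    exact hdisj S hS S' hS' _ (Finset.mem_filter.1 hm).2 (Finset.mem_filter.1 hm').2

theorem theoremA1 {n : ℕ} (P : LatticePolytope n) (hP : P.FullDimensional)
    (φ : MvPolynomial (Fin n) ℂ) (d : ℕ) (hφ : φ.IsHomogeneous d)
    (f : P.Face → ℤ[T;T⁻¹]) :
    (∃ E : Polynomial ℂ[T;T⁻¹], ∀ l : ℕ, 0 < l →
      E.eval (l : ℂ[T;T⁻¹]) = P.weightedEhrhart f φ l) ∧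
    (∀ l : ℕ, 0 < l → P.weightedEhrhart f φ l =
      (1 + LaurentPolynomial.T 1) ^ φ.totalDegree * P.weightedEhrhartTilde f φ l) := by
  constructor
  · choose F hF using fun Q : P.Face => Q.exists_polynomial_relintSum φ
    refine ⟨∑ Q : P.Face, Polynomial.C (LatticePolytope.laurentIncl (f Q) *
      (1 + LaurentPolynomial.T 1) ^ (Q.dim + φ.totalDegree)) *
      (F Q).map LaurentPolynomial.C, fun l hl => ?_⟩
    rw [Polynomial.eval_finsetSum, LatticePolytope.weightedEhrhart]
    refine Finset.sum_congr rfl fun Q _ => ?_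
    rw [Polynomial.eval_mul, Polynomial.eval_C, Polynomial.eval_natCast_map, hF Q l hl]
  · intro l _
    rw [LatticePolytope.weightedEhrhart, LatticePolytope.weightedEhrhartTilde, Finset.mul_sum]
    refine Finset.sum_congr rfl fun Q _ => ?_
    rw [pow_add]
    ring
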